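/- Circuits are acyclic and have two kinds of wires: wires carrying one bit, and wires carrying a payload in $\{0,1\}^w$; a wire may feed any number of gates. The gates are: (i) generalized boolean gates, each computing an arbitrary truth table from at most $3$ bits to at most $3$ bits; (ii) $w$-selector gates, taking a bit $b$ and two payloads $m_0,m_1$ and outputting $m_b$; and (iii) $w$-reverse selector gates, taking a bit $b$ and a payload $m$ and outputting $(m,0^w)$ if $b=0$ and $(0^w,m)$ if $b=1$, which are counted as selector gates. In particular no boolean computation is performed on payloads (the indivisible model). For $n,w\in\mathbb{N}$, an $(n,w)$-loose compactor is such a circuit that takes an array $((b_i,v_i))_{i\in[n]}$ of elements, each given by a bit $b_i\in\{0,1\}$ ($1$: real, $0$: dummy) and a payload $v_i\in\{0,1\}^w$, to an array of $\lfloor n/2\rfloor$ elements of the same form, such that whenever at most $n/128$ of the input elements are real, the multiset of real elements of the output equals the multiset of real elements of the input. **Theorem.** There is a universal constant $C>0$ such that for all $n,w\in\mathbb{N}$ there is an $(n,w)$-loose compactor in the indivisible model with at most $C\,n\log n$ generalized boolean gates and at most $C\,n$ $w$-selector gates (with the convention $0\log 0=0$). -/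

import Mathlib

namespace LooseCompaction

/-- A `w`-bit payload string. -/
abbrev Payload (w : ℕ) : Type := Fin w → Bool

/-- An array element: a metadata bit (`true` = real, `false` = dummy) and a `w`-bit payload. -/
abbrev Element (w : ℕ) : Type := Bool × Payload w

/-- Acyclic circuits in the indivisible model, written as straight-line programs: `Circuit OB OE B E`
is a circuit in which, at the current point, the bit wires `B` and the payload wires `E` are
available, and whose final outputs are bits indexed by `OB` and payloads indexed by `OE`.
Each constructor other than `output` is one gate, which reads available wires (with unbounded
fan-out of wires) and makes its outputs available to everything after it.
No gate computes a bit from a payload, and payloads are only moved by selector gates. -/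
inductive Circuit (OB OE : Type) : Type → Type → Type 1
  /-- The end of the circuit: every output is wired to an available wire of its kind. -/
  | output {B E : Type} (bits : OB → B) (payloads : OE → E) : Circuit OB OE B E
  /-- A generalized boolean gate: an arbitrary truth table from at most 3 bits to at most 3 bits. -/
  | bool {B E : Type} (k l : ℕ) (hk : k ≤ 3) (hl : l ≤ 3) (inputs : Fin k → B)
      (table : (Fin k → Bool) → (Fin l → Bool))
      (rest : Circuit OB OE (B ⊕ Fin l) E) : Circuit OB OE B E
  /-- A selector gate: from a bit `b` and payloads `m₀, m₁`, it outputs `m_b`. -/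
  | selector {B E : Type} (b : B) (m₀ m₁ : E)
      (rest : Circuit OB OE B (E ⊕ Fin 1)) : Circuit OB OE B E
  /-- A reverse selector gate: from a bit `b` and a payload `m`, it outputs
  `(m, 0^w)` if `b = 0` and `(0^w, m)` if `b = 1`. -/
  | reverseSelector {B E : Type} (b : B) (m : E)
      (rest : Circuit OB OE B (E ⊕ Fin 2)) : Circuit OB OE B E

namespace Circuit

variable {OB OE : Type}

/-- The values of the outputs on payloads of width `w`, given the values of the available wires. -/
def eval {w : ℕ} : {B E : Type} → Circuit OB OE B E → (B → Bool) → (E → Payload w) →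
    (OB → Bool) × (OE → Payload w)
  | _, _, output bits payloads, β, ε => (fun o => β (bits o), fun o => ε (payloads o))
  | _, _, bool _ _ _ _ inputs table rest, β, ε =>
      rest.eval (Sum.elim β (table fun i => β (inputs i))) ε
  | _, _, selector b m₀ m₁ rest, β, ε =>
      rest.eval β (Sum.elim ε fun _ => if β b then ε m₁ else ε m₀)
  | _, _, reverseSelector b m rest, β, ε =>
      rest.eval β (Sum.elim ε
        (if β b then ![fun _ => false, ε m] else ![ε m, fun _ => false]))

/-- The number of generalized boolean gates. -/
def boolGates : {B E : Type} → Circuit OB OE B E → ℕ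
  | _, _, output _ _ => 0
  | _, _, bool _ _ _ _ _ _ rest => rest.boolGates + 1
  | _, _, selector _ _ _ rest => rest.boolGates
  | _, _, reverseSelector _ _ rest => rest.boolGates

/-- The number of selector and reverse selector gates. -/
def selectorGates : {B E : Type} → Circuit OB OE B E → ℕ
  | _, _, output _ _ => 0
  | _, _, bool _ _ _ _ _ _ rest => rest.selectorGates
  | _, _, selector _ _ _ rest => rest.selectorGates + 1
  | _, _, reverseSelector _ _ rest => rest.selectorGates + 1

end Circuit

/-- Circuits that take an array of `n` elements to an array of `n'` elements: both the inputs and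
the outputs consist of one metadata bit and one payload per element. -/
abbrev ArrayCircuit (n n' : ℕ) : Type 1 := Circuit (Fin n') (Fin n') (Fin n) (Fin n)

/-- The output array of an array circuit on an input array of elements with `w`-bit payloads. -/
def ArrayCircuit.run {n n' w : ℕ} (c : ArrayCircuit n n') (I : Fin n → Element w) :
    Fin n' → Element w :=
  let out := Circuit.eval c (fun i => (I i).1) (fun i => (I i).2)
  fun j => (out.1 j, out.2 j)

/-- The multiset of real elements contained in an array. -/
def realElements {n w : ℕ} (I : Fin n → Element w) : Multiset (Element w) :=
  (Finset.univ.val.map I).filter fun x => x.1 = true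

/-- `c` is an `(n, w)`-loose compactor: on every array of `n` elements at most `n / 128` of which
are real, it outputs an array of `⌊n / 2⌋` elements with the same multiset of real elements. -/
def IsLooseCompactor (n w : ℕ) (c : ArrayCircuit n (n / 2)) : Prop :=
  ∀ I : Fin n → Element w, (Multiset.card (realElements I) : ℝ) ≤ (n : ℝ) / 128 →
    realElements (ArrayCircuit.run c I) = realElements I

end LooseCompaction

/-! For `n < 128` no input may be real, so wires alone suffice. Otherwise fix a bipartite graph from
the `n` inputs to the `m = n / 2` outputs, of left degree 17, in which every nonempty set of `k ≤ m
/ 64` inputs has more than `9 k` neighbours; a union bound over random graphs gives one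
(`exists_expander`). The at most `n / 128` real inputs lie within this range.

The circuit matches the real inputs into the outputs by peeling. In a round, every output determines
whether at least two edges from unmatched real inputs reach it, and each unmatched real input takes
an edge that is alone at its output. Since 17 edges per vertex cover more than 9 outputs per vertex,
more than `k` outputs are reached exactly once when `k` inputs are unmatched, so at least one input
in 17 is matched (`peel_card_le`). After more than `17 log n` rounds none is left.

A round costs `O(n)` boolean gates and touches no payload. Payloads move only once, at the end, with
one selector per edge: hence `O(n log n)` boolean gates but `O(n)` selectors. -/

namespace LooseCompaction

/-! ### Rewiring circuits and compiling register programs into them. -/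

namespace Circuit

variable {OB OE : Type}

/-- Rewires the inputs of a circuit. -/
def rename : {B E B' E' : Type} → Circuit OB OE B E → (B → B') → (E → E') → Circuit OB OE B' E'
  | _, _, _, _, output bits payloads, ρ, σ => output (ρ ∘ bits) (σ ∘ payloads)
  | _, _, _, _, bool k l hk hl inputs table rest, ρ, σ =>
      bool k l hk hl (ρ ∘ inputs) table (rest.rename (Sum.map ρ id) σ)
  | _, _, _, _, selector b m₀ m₁ rest, ρ, σ =>
      selector (ρ b) (σ m₀) (σ m₁) (rest.rename ρ (Sum.map σ id))
  | _, _, _, _, reverseSelector b m rest, ρ, σ =>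
      reverseSelector (ρ b) (σ m) (rest.rename ρ (Sum.map σ id))

theorem eval_rename {w : ℕ} {B E B' E' : Type} (c : Circuit OB OE B E) (ρ : B → B') (σ : E → E')
    (β : B' → Bool) (ε : E' → Payload w) :
    (c.rename ρ σ).eval β ε = c.eval (β ∘ ρ) (ε ∘ σ) := by
  induction c generalizing B' E' with
  | output => rfl
  | bool k l hk hl inputs table rest ih => simp [rename, eval, ih, Sum.elim_comp_map]
  | selector b m₀ m₁ rest ih => simp [rename, eval, ih, Sum.elim_comp_map]
  | reverseSelector b m rest ih => simp [rename, eval, ih, Sum.elim_comp_map]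

@[simp]
theorem boolGates_rename {B E B' E' : Type} (c : Circuit OB OE B E) (ρ : B → B') (σ : E → E') :
    (c.rename ρ σ).boolGates = c.boolGates := by
  induction c generalizing B' E' with
  | output => rfl
  | _ => simp [rename, boolGates, *]

@[simp]
theorem selectorGates_rename {B E B' E' : Type} (c : Circuit OB OE B E) (ρ : B → B')
    (σ : E → E') : (c.rename ρ σ).selectorGates = c.selectorGates := by
  induction c generalizing B' E' with
  | output => rfl
  | _ => simp [rename, selectorGates, *]

end Circuit

/-- An assignment in an imperative program with bit registers `X` and payload registers `Y`. -/
inductive Instr (X Y : Type) : Type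
  /-- `x := t a b c`. -/
  | bit (x a b c : X) (t : Bool → Bool → Bool → Bool)
  /-- `y := if b then y₁ else y₀`. -/
  | pay (y : Y) (b : X) (y₀ y₁ : Y)

namespace Instr

variable {X Y : Type}

/-- The number of assignments to bit registers. -/
def bitCount : List (Instr X Y) → ℕ
  | [] => 0
  | bit .. :: p => bitCount p + 1
  | pay .. :: p => bitCount p

/-- The number of assignments to payload registers. -/
def payCount : List (Instr X Y) → ℕ
  | [] => 0
  | bit .. :: p => payCount p
  | pay .. :: p => payCount p + 1

theorem bitCount_append (p q : List (Instr X Y)) :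
    bitCount (p ++ q) = bitCount p + bitCount q := by
  induction p with
  | nil => simp [bitCount]
  | cons i p ih => cases i <;> simp [bitCount, ih]; omega

theorem payCount_append (p q : List (Instr X Y)) :
    payCount (p ++ q) = payCount p + payCount q := by
  induction p with
  | nil => simp [payCount]
  | cons i p ih => cases i <;> simp [payCount, ih]; omega

theorem bitCount_flatMap {ι : Type} (L : List ι) (body : ι → List (Instr X Y)) (k : ℕ)
    (h : ∀ i, bitCount (body i) = k) : bitCount (L.flatMap body) = L.length * k := by
  induction L with
  | nil => simp [bitCount]
  | cons a L ih => simp [bitCount_append, ih, h]; ring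

theorem payCount_flatMap {ι : Type} (L : List ι) (body : ι → List (Instr X Y)) (k : ℕ)
    (h : ∀ i, payCount (body i) = k) : payCount (L.flatMap body) = L.length * k := by
  induction L with
  | nil => simp [payCount]
  | cons a L ih => simp [payCount_append, ih, h]; ring

variable [DecidableEq X] [DecidableEq Y]

/-- The effect of one assignment on the registers. -/
def step {w : ℕ} : Instr X Y → (X → Bool) × (Y → Payload w) → (X → Bool) × (Y → Payload w)
  | bit x a b c t, st => (Function.update st.1 x (t (st.1 a) (st.1 b) (st.1 c)), st.2)
  | pay y b y₀ y₁, st => (st.1, Function.update st.2 y (if st.1 b then st.2 y₁ else st.2 y₀))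

/-- The effect of a program on the registers. -/
def exec {w : ℕ} (p : List (Instr X Y)) (st : (X → Bool) × (Y → Payload w)) :
    (X → Bool) × (Y → Payload w) :=
  p.foldl (fun st i => i.step st) st

theorem exec_append {w : ℕ} (p q : List (Instr X Y)) (st : (X → Bool) × (Y → Payload w)) :
    exec (p ++ q) st = exec q (exec p st) := by
  simp [exec]

/-- Translates a program, followed by a circuit reading the registers, into a circuit. -/
def compile {OB OE : Type} : List (Instr X Y) → Circuit OB OE X Y → Circuit OB OE X Y
  | [], c => c
  | bit x a b d t :: p, c =>
      .bool 3 1 le_rfl (by omega) ![a, b, d] (fun v _ => t (v 0) (v 1) (v 2))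
        -- An assignment becomes a fresh wire: the remaining circuit reads it wherever it read the
        -- assigned register, and all other registers keep their wires.
        ((compile p c).rename (fun z => if z = x then .inr 0 else .inl z) id)
  | pay y b y₀ y₁ :: p, c =>
      .selector b y₀ y₁ ((compile p c).rename id (fun z => if z = y then .inr 0 else .inl z))

theorem eval_compile {OB OE : Type} {w : ℕ} (p : List (Instr X Y)) (c : Circuit OB OE X Y)
    (β : X → Bool) (ε : Y → Payload w) :
    (compile p c).eval β ε = c.eval (exec p (β, ε)).1 (exec p (β, ε)).2 := by
  induction p generalizing β ε with
  | nil => rfl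
  | cons i p ih =>
    cases i with
    | bit x a b d t =>
      simp only [compile, Circuit.eval, Circuit.eval_rename, ih, exec, List.foldl_cons, step]
      congr! 4 <;>
      · ext z
        by_cases h : z = x <;> simp [h]
    | pay y b y₀ y₁ =>
      simp only [compile, Circuit.eval, Circuit.eval_rename, ih, exec, List.foldl_cons, step]
      congr! 4 <;>
      · ext z
        by_cases h : z = y <;> simp [h]

theorem boolGates_compile {OB OE : Type} (p : List (Instr X Y)) (c : Circuit OB OE X Y) :
    (compile p c).boolGates = bitCount p + c.boolGates := by
  induction p with
  | nil => simp [compile, bitCount]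
  | cons i p ih => cases i <;> simp [compile, bitCount, Circuit.boolGates, ih]; omega

theorem selectorGates_compile {OB OE : Type} (p : List (Instr X Y)) (c : Circuit OB OE X Y) :
    (compile p c).selectorGates = payCount p + c.selectorGates := by
  induction p with
  | nil => simp [compile, payCount]
  | cons i p ih => cases i <;> simp [compile, payCount, Circuit.selectorGates, ih]; omega

end Instr

/-! ### Existence of the expander by counting. -/

open Finset

/-- Counts the maps that send all edges at `s` into `t`, in a graph with edge set `S × D`. -/
theorem card_filter_image_subset {S D T : Type} [Fintype S] [Fintype D] [Fintype T]
    [DecidableEq S] [DecidableEq D] [DecidableEq T] (s : Finset S) (t : Finset T) :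
    (univ.filter fun f : S × D → T => ∀ e, e.1 ∈ s → f e ∈ t).card *
        Fintype.card T ^ (Fintype.card D * s.card) =
      t.card ^ (Fintype.card D * s.card) * Fintype.card T ^ (Fintype.card S * Fintype.card D) := by
  have h : (univ.filter fun f : S × D → T => ∀ e, e.1 ∈ s → f e ∈ t) =
      Fintype.piFinset fun e : S × D => if e.1 ∈ s then t else univ := by
    ext f
    simp only [mem_filter, mem_univ, true_and, Fintype.mem_piFinset]
    refine forall_congr' fun e => ?_
    by_cases he : e.1 ∈ s <;> simp [he]
  rw [h, Fintype.card_piFinset]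
  have h2 : ∏ e : S × D, (if e.1 ∈ s then t else univ).card =
      t.card ^ (Fintype.card D * s.card) *
        Fintype.card T ^ (Fintype.card D * (univ.filter fun x => x ∉ s).card) := by
    rw [Fintype.prod_prod_type]
    have h3 : ∀ x : S, ∏ y : D, (if (x, y).1 ∈ s then t else univ).card =
        if x ∈ s then t.card ^ Fintype.card D else Fintype.card T ^ Fintype.card D := by
      intro x
      by_cases hx : x ∈ s <;> simp [hx]
    rw [prod_congr rfl fun x _ => h3 x, Finset.prod_ite]
    simp [pow_mul]
  rw [h2, mul_assoc, ← pow_add, ← mul_add, add_comm]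
  congr 2
  have : (univ.filter fun x => x ∈ s).card + (univ.filter fun x => x ∉ s).card = Fintype.card S :=
    Finset.card_filter_add_card_filter_not _
  simp only [Finset.filter_univ_mem] at this
  rw [this, mul_comm]

theorem choose_le_exp_mul_div_pow (n k : ℕ) (hk : 0 < k) :
    (n.choose k : ℝ) ≤ (Real.exp 1 * n / k) ^ k := by
  have h1 : (n.choose k : ℝ) ≤ (n : ℝ) ^ k / k.factorial := Nat.choose_le_pow_div k n
  have h2 : (k : ℝ) ^ k / k.factorial ≤ Real.exp k := Real.pow_div_factorial_le_exp _ (by positivity) _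
  have hk' : (0 : ℝ) < k := by exact_mod_cast hk
  have h3 : (Real.exp 1 * n / k) ^ k = Real.exp k * ((n : ℝ) ^ k / (k : ℝ) ^ k) := by
    rw [div_pow, mul_pow, ← Real.exp_nat_mul, mul_one, mul_div_assoc]
  rw [h3]
  refine h1.trans ?_
  calc (n : ℝ) ^ k / k.factorial = (k : ℝ) ^ k / k.factorial * ((n : ℝ) ^ k / (k : ℝ) ^ k) := by
        field_simp
    _ ≤ _ := by gcongr

/-- This bounds the share of bad graphs due to sets of size `k`. By `(n choose k) ≤ (e n / k) ^ k`
the powers of `k` collect into `(e ^ 10 * 9 ^ 8 * (n / m) * (k / m) ^ 7) ^ k`. Here `m ≥ 64` gives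
`n / m ≤ 2 + 1 / 64`, and the base is then about 0.44. -/
theorem expansion_term_le {n m k : ℕ} (hk : 0 < k) (hkm : 64 * k ≤ m) (hnm : n ≤ 2 * m + 1) :
    (n.choose k : ℝ) * m.choose (9 * k) * ((9 * k : ℝ) / m) ^ (17 * k) ≤ (9 / 20 : ℝ) ^ k := by
  have hk' : (1 : ℝ) ≤ k := by exact_mod_cast hk
  have hkm' : (64 : ℝ) * k ≤ m := by exact_mod_cast hkm
  have hnm' : (n : ℝ) ≤ 2 * m + 1 := by exact_mod_cast hnm
  have hm : (0 : ℝ) < m := by linarith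
  have h1 := choose_le_exp_mul_div_pow n k hk
  have h2 := choose_le_exp_mul_div_pow m (9 * k) (by omega)
  have e1 : Real.exp 1 ≤ 2.72 := by have := Real.exp_one_lt_d9; linarith
  calc _ ≤ (Real.exp 1 * n / k) ^ k * (Real.exp 1 * m / (9 * k : ℕ)) ^ (9 * k) *
        ((9 * k : ℝ) / m) ^ (17 * k) := by gcongr
    _ = (Real.exp 1 ^ 10 * 9 ^ 8 * (n / m) * (k / m) ^ 7) ^ k := by
        rw [pow_mul _ 9 k, pow_mul _ 17 k, ← mul_pow, ← mul_pow]
        congr 1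
        push_cast
        field_simp
    _ ≤ _ := by
        have hn : (n / m : ℝ) ≤ 129 / 64 := by
          rw [div_le_iff₀ hm]; linarith
        have hkm2 : (k / m : ℝ) ≤ 1 / 64 := by
          rw [div_le_iff₀ hm]; linarith
        have : Real.exp 1 ^ 10 * 9 ^ 8 * (n / m) * (k / m) ^ 7 ≤
            (2.72 : ℝ) ^ 10 * 9 ^ 8 * (129 / 64) * (1 / 64) ^ 7 := by gcongr
        refine pow_le_pow_left₀ (by positivity) (this.trans ?_) k
        norm_num

/-- There are graphs with `17` edges at each of `n` vertices on the left and `m` vertices on the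
right in which every set of `k ≤ m / 64` left vertices has more than `9 k` neighbours. -/
theorem exists_expander {n m : ℕ} (hm : 0 < m) (hnm : n ≤ 2 * m + 1) :
    ∃ f : Fin n × Fin 17 → Fin m, ∀ s : Finset (Fin n), s.Nonempty → 64 * s.card ≤ m →
      9 * s.card < ((s ×ˢ univ).image f).card := by
  by_contra! hcon
  set P := (univ : Finset (Finset (Fin n))).filter fun s => s.Nonempty ∧ 64 * s.card ≤ m
  let A (s : Finset (Fin n)) (t : Finset (Fin m)) :=
    univ.filter fun f : Fin n × Fin 17 → Fin m => ∀ e, e.1 ∈ s → f e ∈ t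
  have hcover : (univ : Finset (Fin n × Fin 17 → Fin m)) ⊆
      P.biUnion fun s => (powersetCard (9 * s.card) univ).biUnion fun t => A s t := by
    intro f _
    obtain ⟨s, hs, hsm, hle⟩ := hcon f
    -- The neighbourhood is enlarged to exactly `9 k` vertices, so that the union bound runs over
    -- one size only; there is room because `9 k ≤ 64 k ≤ m`.
    obtain ⟨t, hst, -, ht⟩ := exists_subsuperset_card_eq (subset_univ ((s ×ˢ univ).image f)) hle
      (by simp; omega)
    simp only [mem_biUnion]
    refine ⟨s, by simp [P, hs, hsm], t, by simp [mem_powersetCard, ht], ?_⟩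
    simp only [A, mem_filter, mem_univ, true_and]
    exact fun e he => hst (mem_image_of_mem _ (by simp [he]))
  have hm' : (0 : ℝ) < m := by exact_mod_cast hm
  have hA : ∀ s : Finset (Fin n), ∀ t ∈ powersetCard (9 * s.card) (univ : Finset (Fin m)),
      ((A s t).card : ℝ) = ((9 * s.card : ℝ) / m) ^ (17 * s.card) * (m : ℝ) ^ (n * 17) := by
    intro s t ht
    have h := card_filter_image_subset (D := Fin 17) s t
    rw [(mem_powersetCard.1 ht).2] at h
    simp only [Fintype.card_fin] at h
    have h' : ((A s t).card : ℝ) * (m : ℝ) ^ (17 * s.card) =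
      (9 * s.card : ℝ) ^ (17 * s.card) * (m : ℝ) ^ (n * 17) := by exact_mod_cast h
    rw [div_pow]
    field_simp
    linarith
  have hP : ∑ s ∈ P, ((powersetCard (9 * s.card) (univ : Finset (Fin m))).card : ℝ) *
      ((9 * s.card : ℝ) / m) ^ (17 * s.card) < 1 := by
    have hsub : P = (Finset.Icc 1 (m / 64)).biUnion fun k => powersetCard k univ := by
      ext s
      simp only [P, mem_filter, mem_univ, true_and, mem_biUnion, mem_Icc, mem_powersetCard,
        subset_univ, exists_eq_right', Finset.one_le_card]
      rw [Nat.le_div_iff_mul_le (by norm_num), mul_comm]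
    rw [hsub, sum_biUnion]
    · calc _ ≤ ∑ k ∈ Finset.Icc 1 (m / 64), (9 / 20 : ℝ) ^ k := by
            refine sum_le_sum fun k hk => ?_
            rw [mem_Icc] at hk
            have := expansion_term_le (n := n) (m := m) (k := k) (by omega) (by omega) hnm
            refine le_trans (le_of_eq ?_) this
            rw [sum_congr rfl (g := fun _ => (m.choose (9 * k) : ℝ) *
              ((9 * k : ℝ) / m) ^ (17 * k))]
            · simp [mul_assoc]
            · intro s hs
              rw [(mem_powersetCard.1 hs).2]
              simp
        -- The geometric sum telescopes and stays below `(9 / 20) / (11 / 20) = 9 / 11`.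
        _ ≤ ∑ k ∈ Finset.Icc 1 (m / 64), (11 / 20 : ℝ)⁻¹ *
              ((9 / 20 : ℝ) ^ k - (9 / 20 : ℝ) ^ (k + 1)) := by
            refine sum_le_sum fun k _ => le_of_eq ?_
            ring
        _ < 1 := by
            rw [← mul_sum, ← Finset.Ico_succ_right_eq_Icc]
            have := Finset.sum_Ico_sub (fun k => -(9 / 20 : ℝ) ^ k)
              (show 1 ≤ Order.succ (m / 64) by simp)
            simp only [neg_sub_neg] at this
            rw [this]
            have : (0 : ℝ) < (9 / 20 : ℝ) ^ Order.succ (m / 64) := by positivity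
            linarith
    · intro a _ b _ hab
      exact pairwise_disjoint_powersetCard univ hab
  have hcard : ((univ : Finset (Fin n × Fin 17 → Fin m)).card : ℝ) ≤
      ∑ s ∈ P, ∑ t ∈ powersetCard (9 * s.card) (univ : Finset (Fin m)), ((A s t).card : ℝ) := by
    have h := (card_le_card hcover).trans (card_biUnion_le.trans
      (sum_le_sum fun s _ => card_biUnion_le))
    exact_mod_cast h
  have hpos : (0 : ℝ) < (m : ℝ) ^ (n * 17) := by positivity
  have : (m : ℝ) ^ (n * 17) < (m : ℝ) ^ (n * 17) := by
    calc (m : ℝ) ^ (n * 17) = ((univ : Finset (Fin n × Fin 17 → Fin m)).card : ℝ) := by simp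
      _ ≤ _ := hcard
      _ = (∑ s ∈ P, ((powersetCard (9 * s.card) (univ : Finset (Fin m))).card : ℝ) *
            ((9 * s.card : ℝ) / m) ^ (17 * s.card)) * (m : ℝ) ^ (n * 17) := by
          rw [sum_mul]
          refine sum_congr rfl fun s _ => ?_
          rw [sum_congr rfl (hA s), sum_const, nsmul_eq_mul, mul_assoc]
      _ < 1 * (m : ℝ) ^ (n * 17) := by gcongr
      _ = _ := one_mul _
  exact lt_irrefl _ this

/-! ### The matching program and its cost. -/

open Finset

/-- Bit registers of the compactor on a graph from `S` to `T` with edge set `S × D`. -/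
inductive BitReg (S D T : Type) : Type
  /-- Is this left vertex real and not matched yet? -/
  | act (s : S)
  /-- Has this right vertex at least one active edge? -/
  | one (t : T)
  /-- Has this right vertex at least two active edges? -/
  | two (t : T)
  /-- Is this edge in the matching? -/
  | sel (e : S × D)
  /-- Is this right vertex matched? -/
  | out (t : T)
  deriving DecidableEq

/-- Programs of the compactor: the payload registers hold the inputs and the outputs. -/
abbrev Prog (S D T : Type) : Type := List (Instr (BitReg S D T) (S ⊕ T))

/-- Register contents of the compactor. -/
abbrev Mem (S D T : Type) (w : ℕ) : Type := (BitReg S D T → Bool) × (S ⊕ T → Payload w)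

namespace Prog

open Instr BitReg

variable {S D T : Type} (f : S × D → T)

/-- Resets a register. -/
def clear (x : BitReg S D T) : Instr (BitReg S D T) (S ⊕ T) :=
  bit x x x x fun _ _ _ => false

/-- Counts an edge at its right end. -/
def tally (e : S × D) : Prog S D T :=
  -- `two` comes first because it needs the value of `one` from before this edge.
  [bit (two (f e)) (two (f e)) (one (f e)) (act e.1) fun a b c => a || (b && c),
   bit (one (f e)) (one (f e)) (one (f e)) (act e.1) fun a _ c => a || c]

/-- Matches an active edge if it is alone at its right end. -/
def choose (e : S × D) : Prog S D T :=
  -- `sel` must read `act` before it is cleared. Clearing `act` at once prevents a vertex with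
  -- several lone edges from selecting a second one.
  [bit (sel e) (sel e) (act e.1) (two (f e)) fun a b c => a || (b && !c),
   bit (act e.1) (act e.1) (act e.1) (two (f e)) fun a _ c => a && c]

/-- Moves the element at the left end of a matched edge to its right end. -/
def move (e : S × D) : Prog S D T :=
  [bit (out (f e)) (out (f e)) (sel e) (sel e) fun a b _ => a || b,
   pay (.inr (f e)) (sel e) (.inr (f e)) (.inl e.1)]

/-- One round of matching. -/
def round (LE : List (S × D)) (LT : List T) : Prog S D T :=
  LT.flatMap (fun t => [clear (one t), clear (two t)]) ++
    LE.flatMap (tally f) ++ LE.flatMap (choose f)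

/-- The compactor with a given number of rounds. -/
def compactor (LE : List (S × D)) (LT : List T) (rounds : ℕ) : Prog S D T :=
  LE.flatMap (fun e => [clear (sel e)]) ++ LT.flatMap (fun t => [clear (out t)]) ++
    (List.range rounds).flatMap (fun _ => round f LE LT) ++ LE.flatMap (move f)

theorem bitCount_compactor (LE : List (S × D)) (LT : List T) (r : ℕ) :
    bitCount (compactor f LE LT r) =
      2 * LE.length + LT.length + r * (2 * LT.length + 4 * LE.length) := by
  have hround : bitCount (round f LE LT) = 2 * LT.length + 4 * LE.length := by
    rw [round, bitCount_append, bitCount_append, bitCount_flatMap _ _ 2 fun _ => rfl,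
      bitCount_flatMap _ _ 2 fun _ => rfl, bitCount_flatMap _ _ 2 fun _ => rfl]
    ring
  rw [compactor, bitCount_append, bitCount_append, bitCount_append,
    bitCount_flatMap _ _ 1 fun _ => rfl, bitCount_flatMap _ _ 1 fun _ => rfl,
    bitCount_flatMap _ _ _ fun _ => hround, bitCount_flatMap _ _ 1 fun _ => rfl, List.length_range]
  ring

/-- Only the final moves assign payloads, so the count does not depend on the number of rounds. -/
theorem payCount_compactor (LE : List (S × D)) (LT : List T) (r : ℕ) :
    payCount (compactor f LE LT r) = LE.length := by
  have hround : payCount (round f LE LT) = 0 := by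
    rw [round, payCount_append, payCount_append, payCount_flatMap _ _ 0 fun _ => rfl,
      payCount_flatMap _ _ 0 fun _ => rfl, payCount_flatMap _ _ 0 fun _ => rfl]
    ring
  rw [compactor, payCount_append, payCount_append, payCount_append,
    payCount_flatMap _ _ 0 fun _ => rfl, payCount_flatMap _ _ 0 fun _ => rfl,
    payCount_flatMap _ _ _ fun _ => hround, payCount_flatMap _ _ 1 fun _ => rfl]
  ring

variable [DecidableEq S] [DecidableEq D] [DecidableEq T] {w : ℕ}

/-- The effect of a loop keeps every property that its body keeps. -/
theorem exec_flatMap_induction {X Y ι : Type} [DecidableEq X] [DecidableEq Y]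
    (body : ι → List (Instr X Y)) (P : (X → Bool) × (Y → Payload w) → Prop)
    (h : ∀ i m, P m → P (exec (body i) m)) (L : List ι) (m : (X → Bool) × (Y → Payload w))
    (hm : P m) : P (exec (L.flatMap body) m) := by
  induction L generalizing m with
  | nil => exact hm
  | cons a L ih =>
    rw [List.flatMap_cons, exec_append]
    exact ih _ (h _ _ hm)

theorem exec_clear {ι : Type} (regs : ι → List (BitReg S D T)) (L : List ι)
    (m : Mem S D T w) (x : BitReg S D T) :
    (exec (L.flatMap fun i => (regs i).map clear) m).1 x =
      (m.1 x && !decide (∃ i ∈ L, x ∈ regs i)) := by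
  have aux : ∀ (l : List (BitReg S D T)) (m : Mem S D T w),
      (exec (l.map clear) m).1 x = (m.1 x && !decide (x ∈ l)) := by
    intro l
    induction l with
    | nil => intro m; simp [exec]
    | cons y l ih =>
      intro m
      have : exec ((y :: l).map clear) m = exec (l.map clear) ((clear y).step m) := rfl
      rw [this, ih]
      by_cases hxy : x = y <;> simp [clear, step, hxy]
  induction L generalizing m with
  | nil => simp [exec]
  | cons i L ih =>
    rw [List.flatMap_cons, exec_append, ih, aux]
    by_cases h1 : x ∈ regs i <;> simp [h1]

end Prog

/-! ### Correctness and progress of the matching rounds. -/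

open Finset

namespace Prog

open Instr BitReg

variable {S D T : Type} (f : S × D → T) {w : ℕ}

/-- What holds between the rounds: the selected edges form a matching of real elements, which the
active vertices extend. -/
structure Inv (real : S → Bool) (v : S → Payload w) (m : Mem S D T w) : Prop where
  real_iff : ∀ s, real s = true ↔ m.1 (act s) = true ∨ ∃ i, m.1 (sel (s, i)) = true
  sel_of_act : ∀ e : S × D, m.1 (act e.1) = true → m.1 (sel e) = false
  src_inj : ∀ e e' : S × D, m.1 (sel e) = true → m.1 (sel e') = true → e.1 = e'.1 → e = e'
  dst_inj : ∀ e e' : S × D, m.1 (sel e) = true → m.1 (sel e') = true → f e = f e' → e = e'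
  dst_ne : ∀ e e' : S × D, m.1 (sel e) = true → m.1 (act e'.1) = true → f e ≠ f e'
  out_eq : ∀ t, m.1 (out t) = false
  pay_eq : ∀ s, m.2 (.inl s) = v s

theorem Inv.congr {real : S → Bool} {v : S → Payload w} {m m' : Mem S D T w}
    (h : Inv f real v m) (hact : ∀ s, m'.1 (act s) = m.1 (act s))
    (hsel : ∀ e, m'.1 (sel e) = m.1 (sel e)) (hout : ∀ t, m'.1 (out t) = m.1 (out t))
    (hpay : m'.2 = m.2) : Inv f real v m' := by
  obtain ⟨h1, h2, h3, h4, h5, h6, h7⟩ := h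
  constructor <;> simpa only [hact, hsel, hout, hpay]

variable [DecidableEq S] [DecidableEq D] [DecidableEq T]

theorem tally_frame (L : List (S × D)) (m : Mem S D T w) :
    (∀ s, (exec (L.flatMap (tally f)) m).1 (act s) = m.1 (act s)) ∧
    (∀ e, (exec (L.flatMap (tally f)) m).1 (sel e) = m.1 (sel e)) ∧
    (∀ t, (exec (L.flatMap (tally f)) m).1 (out t) = m.1 (out t)) ∧
    (exec (L.flatMap (tally f)) m).2 = m.2 := by
  refine exec_flatMap_induction (tally f) (fun m' => (∀ s, m'.1 (act s) = m.1 (act s)) ∧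
    (∀ e, m'.1 (sel e) = m.1 (sel e)) ∧ (∀ t, m'.1 (out t) = m.1 (out t)) ∧ m'.2 = m.2) ?_ L m
    ⟨fun _ => rfl, fun _ => rfl, fun _ => rfl, rfl⟩
  rintro e m' ⟨h1, h2, h3, h4⟩
  simp [exec, tally, step, h1, h2, h3, h4]

/-- The registers `one` and `two` form a counter saturating at 2; the induction carries arbitrary
initial counts `c`. -/
theorem tally_two (L : List (S × D)) (m : Mem S D T w) (a : S → Bool) (c : T → ℕ)
    (ha : ∀ s, m.1 (act s) = a s) (h1 : ∀ t, m.1 (one t) = decide (1 ≤ c t))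
    (h2 : ∀ t, m.1 (two t) = decide (2 ≤ c t)) (t : T) :
    (exec (L.flatMap (tally f)) m).1 (two t) =
      decide (2 ≤ c t + L.countP fun e => a e.1 && decide (f e = t)) := by
  induction L generalizing m c with
  | nil => simp [exec, h2]
  | cons e L ih =>
    rw [List.flatMap_cons, exec_append,
      ih _ fun t => c t + if a e.1 && decide (f e = t) then 1 else 0]
    · rw [List.countP_cons, add_assoc, add_comm (ite _ _ _)]
    · intro s
      simp [exec, tally, step, ha]
    · intro t
      by_cases ht : t = f e
      · subst ht
        cases hae : a e.1 <;> simp [exec, tally, step, ha, h1, hae]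
      · simp [exec, tally, step, h1, ht, Ne.symm ht]
    · intro t
      by_cases ht : t = f e
      · subst ht
        cases hae : a e.1 <;> simp [exec, tally, step, ha, h1, h2, hae]
        omega
      · simp [exec, tally, step, h2, ht, Ne.symm ht]

/-- The register `two t` is set unless at most one active edge ends at `t`. -/
def TwoSet (m : Mem S D T w) : Prop :=
  ∀ e e' : S × D, m.1 (act e.1) = true → m.1 (act e'.1) = true → f e = f e' →
    m.1 (two (f e)) = false → e = e'

/-- If `e` is selected, its source had no selected edge because it was active, and its target had
none by `dst_ne`. `TwoSet` says that no other active edge ends there, which restores `dst_ne`. The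
tallies may be stale during a sweep, but active vertices only disappear, so `TwoSet` survives. -/
theorem Inv.choose_step {real : S → Bool} {v : S → Payload w} (e : S × D) {m : Mem S D T w}
    (h : Inv f real v m) (h2 : TwoSet f m) :
    Inv f real v (exec (choose f e) m) ∧ TwoSet f (exec (choose f e) m) := by
  have hact : ∀ s, (exec (choose f e) m).1 (act s) =
      if s = e.1 then m.1 (act s) && m.1 (two (f e)) else m.1 (act s) := by
    intro s
    by_cases hs : s = e.1 <;> simp [exec, choose, step, hs]
  have hsel : ∀ e', (exec (choose f e) m).1 (sel e') =
      if e' = e then m.1 (sel e') || (m.1 (act e.1) && !m.1 (two (f e))) else m.1 (sel e') := by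
    intro e'
    by_cases hs : e' = e <;> simp [exec, choose, step, hs]
  have hout : ∀ t, (exec (choose f e) m).1 (out t) = m.1 (out t) := by
    intro t; simp [exec, choose, step]
  have htwo : ∀ t, (exec (choose f e) m).1 (two t) = m.1 (two t) := by
    intro t; simp [exec, choose, step]
  have hpay : (exec (choose f e) m).2 = m.2 := by simp [exec, choose, step]
  have hmono : ∀ s, (exec (choose f e) m).1 (act s) = true → m.1 (act s) = true := by
    intro s
    rw [hact]
    split_ifs <;> simp +contextual
  by_cases hc : m.1 (act e.1) = true ∧ m.1 (two (f e)) = false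
  · obtain ⟨hc1, hc2⟩ := hc
    have hact' : ∀ s, (exec (choose f e) m).1 (act s) = true ↔ s ≠ e.1 ∧ m.1 (act s) = true := by
      intro s
      rw [hact]
      split_ifs with hs <;> simp [hs, hc2]
    have hsel' : ∀ e', (exec (choose f e) m).1 (sel e') = true ↔ e' = e ∨ m.1 (sel e') = true := by
      intro e'
      rw [hsel]
      split_ifs with hs <;> simp [hs, hc1, hc2]
    have hse := h.sel_of_act e hc1
    refine ⟨⟨fun s => ?_, fun e' => ?_, fun e' e'' => ?_, fun e' e'' => ?_, fun e' e'' => ?_,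
      fun t => by rw [hout, h.out_eq], fun s => by rw [hpay, h.pay_eq]⟩, ?_⟩
    · rw [h.real_iff]
      simp only [hact', hsel']
      by_cases hs : s = e.1
      · subst hs
        simp only [hc1, true_or, ne_eq, not_true_eq_false, false_and, false_or, true_iff]
        exact ⟨e.2, .inl rfl⟩
      · have : ∀ i, (s, i) ≠ e := fun i hi => hs (by rw [← hi])
        simp [hs, this]
    · rw [hact', ← Bool.not_eq_true, hsel']
      rintro ⟨h3, h4⟩ (rfl | h5)
      · exact h3 rfl
      · simp [h.sel_of_act e' h4] at h5
    · rw [hsel', hsel']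
      rintro (rfl | h3) (rfl | h4) h5
      · rfl
      · rw [h.sel_of_act e'' (h5 ▸ hc1)] at h4; cases h4
      · rw [h.sel_of_act e' (h5 ▸ hc1)] at h3; cases h3
      · exact h.src_inj _ _ h3 h4 h5
    · rw [hsel', hsel']
      rintro (rfl | h3) (rfl | h4) h5
      · rfl
      · exact absurd h5.symm (h.dst_ne _ _ h4 hc1)
      · exact absurd h5 (h.dst_ne _ _ h3 hc1)
      · exact h.dst_inj _ _ h3 h4 h5
    · rw [hsel', hact']
      rintro (rfl | h3) ⟨h4, h5⟩ h6
      · exact h4 (by rw [h2 _ _ hc1 h5 h6 hc2])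
      · exact h.dst_ne _ _ h3 h5 h6
    · intro e' e'' h3 h4 h5 h6
      rw [htwo] at h6
      exact h2 _ _ (hmono _ h3) (hmono _ h4) h5 h6
  · have hact' : ∀ s, (exec (choose f e) m).1 (act s) = m.1 (act s) := by
      intro s
      rw [hact]
      split_ifs with hs
      · subst hs
        revert hc
        cases m.1 (act e.1) <;> cases m.1 (two (f e)) <;> simp
      · rfl
    have hsel' : ∀ e', (exec (choose f e) m).1 (sel e') = m.1 (sel e') := by
      intro e'
      rw [hsel]
      split_ifs with hs
      · revert hc
        cases m.1 (act e.1) <;> cases m.1 (two (f e)) <;> simp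
      · rfl
    refine ⟨h.congr f hact' hsel' hout hpay, ?_⟩
    intro e' e'' h3 h4 h5 h6
    rw [htwo] at h6
    exact h2 _ _ (hmono _ h3) (hmono _ h4) h5 h6

theorem choose_act (L : List (S × D)) (m : Mem S D T w) (s : S)
    (h : (exec (L.flatMap (choose f)) m).1 (act s) = true) :
    m.1 (act s) = true ∧ ∀ e ∈ L, e.1 = s → m.1 (two (f e)) = true := by
  induction L generalizing m with
  | nil => simpa [exec] using h
  | cons e L ih =>
    rw [List.flatMap_cons, exec_append] at h
    have htwo : ∀ t, (exec (choose f e) m).1 (two t) = m.1 (two t) := by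
      intro t; simp [exec, choose, step]
    obtain ⟨h1, h2⟩ := ih _ h
    simp only [htwo] at h2
    by_cases hs : s = e.1
    · subst hs
      have : m.1 (act e.1) = true ∧ m.1 (two (f e)) = true := by
        simpa [exec, choose, step] using h1
      exact ⟨this.1, by simpa [this.2] using h2⟩
    · have : m.1 (act s) = true := by simpa [exec, choose, step, hs] using h1
      refine ⟨this, ?_⟩
      simpa [Ne.symm hs] using h2

/-- The active vertices. -/
def active [Fintype S] (m : Mem S D T w) : Finset S :=
  univ.filter fun s => m.1 (act s) = true

/-- This turns a round into a statement about the graph: a vertex can remain active only if each of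
its neighbours had at least two active edges at the start of the round. -/
theorem Inv.round [Fintype S] [Fintype D] [Fintype T] {real : S → Bool} {v : S → Payload w}
    {m : Mem S D T w} (h : Inv f real v m) :
    Inv f real v (exec (round f univ.toList univ.toList) m) ∧
      ∀ s ∈ active (exec (round f univ.toList univ.toList) m), s ∈ active m ∧
        ∀ i, 2 ≤ ((active m ×ˢ univ).filter fun e => f e = f (s, i)).card := by
  rw [Prog.round, exec_append, exec_append]
  set m₁ := exec ((univ : Finset T).toList.flatMap fun t => [clear (one t), clear (two t)]) m
    with hm₁
  set m₂ := exec ((univ : Finset (S × D)).toList.flatMap (tally f)) m₁ with hm₂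
  have hclear : ∀ x, m₁.1 x = (m.1 x && !decide (∃ t : T, x = one t ∨ x = two t)) := by
    intro x
    have := exec_clear (fun t : T => [one t, two t]) (univ : Finset T).toList m x
    simpa using this
  have hm₁2 : m₁.2 = m.2 := by
    refine exec_flatMap_induction _ (fun m' => m'.2 = m.2) ?_ _ _ rfl
    intro t m' h'
    simpa [exec, clear, step] using h'
  have hinv₁ : Inv f real v m₁ := by
    refine h.congr f ?_ ?_ ?_ hm₁2 <;> intro <;> rw [hclear] <;> simp
  obtain ⟨g1, g2, g3, g4⟩ := tally_frame f (univ : Finset (S × D)).toList m₁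
  have hinv₂ : Inv f real v m₂ := hinv₁.congr f g1 g2 g3 g4
  have hact₁ : ∀ s, m₁.1 (act s) = m.1 (act s) := by intro s; rw [hclear]; simp
  have hact₂ : ∀ s, m₂.1 (act s) = m.1 (act s) := by intro s; rw [g1, hact₁]
  have htwo : ∀ t, m₂.1 (two t) =
      decide (2 ≤ ((active m ×ˢ univ).filter fun e : S × D => f e = t).card) := by
    intro t
    rw [hm₂, tally_two f _ m₁ (fun s => m.1 (act s)) (fun _ => 0) hact₁
      (by intro t; rw [hclear]; simp) (by intro t; rw [hclear]; simp), zero_add,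
      List.countP_eq_length_filter, ← List.toFinset_card_of_nodup ((nodup_toList _).filter _)]
    congr 3
    ext e
    simp [active]
  have hset : TwoSet f m₂ := by
    intro e e' h1 h2 h3 h4
    rw [htwo, decide_eq_false_iff_not, not_le, Nat.lt_succ_iff, card_le_one] at h4
    rw [hact₂] at h1 h2
    exact h4 e (by simp [active, h1]) e' (by simp [active, h2, h3])
  refine ⟨?_, ?_⟩
  · refine (exec_flatMap_induction (choose f) (fun m => Inv f real v m ∧ TwoSet f m)
      (fun e m hm => hm.1.choose_step f e hm.2) _ _ ⟨hinv₂, hset⟩).1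
  · intro s hs
    obtain ⟨h1, h2⟩ := choose_act f _ _ _ (by simpa [active] using hs)
    refine ⟨by simpa [active, hact₂] using h1, fun i => ?_⟩
    simpa [htwo] using h2 (s, i) (by simp) rfl

/-- Let `U` be the set of right vertices with exactly one edge from `a`. Counting edges by right end
gives `2 |N(a)| ≤ 17 |a| + |U|`, so `|N(a)| > 9 |a|` forces `|U| > |a|`. A vertex of `b` has no
neighbour in `U`, so `|U| ≤ 17 |a \ b|`. -/
theorem peel_card_le {n m : ℕ} (f : Fin n × Fin 17 → Fin m) (a b : Finset (Fin n))
    (hf : a.Nonempty → 9 * a.card < ((a ×ˢ univ).image f).card)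
    (hb : ∀ s ∈ b, s ∈ a ∧ ∀ i, 2 ≤ ((a ×ˢ univ).filter fun e => f e = f (s, i)).card) :
    17 * b.card ≤ 16 * a.card := by
  rcases a.eq_empty_or_nonempty with rfl | ha
  · have : b = ∅ := eq_empty_of_forall_notMem fun s hs => by simpa using (hb s hs).1
    simp [this]
  have hba : b ⊆ a := fun s hs => (hb s hs).1
  have h1 := card_eq_sum_card_image f (a ×ˢ (univ : Finset (Fin 17)))
  rw [card_product, card_univ, Fintype.card_fin] at h1
  set I := (a ×ˢ (univ : Finset (Fin 17))).image f
  let U := I.filter fun t => ((a ×ˢ univ).filter fun e => f e = t).card < 2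
  have h2 : ∀ t ∈ I, 2 ≤ ((a ×ˢ univ).filter fun e => f e = t).card +
      if ((a ×ˢ univ).filter fun e => f e = t).card < 2 then 1 else 0 := by
    intro t ht
    have : 0 < ((a ×ˢ univ).filter fun e => f e = t).card := by
      obtain ⟨e, he, het⟩ := mem_image.1 ht
      exact card_pos.2 ⟨e, by simpa [het] using he⟩
    split_ifs <;> omega
  have h3 := sum_le_sum h2
  rw [sum_add_distrib, ← h1, sum_const, smul_eq_mul, ← card_filter] at h3
  have h4 : U ⊆ ((a \ b) ×ˢ univ).image f := by
    intro t ht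
    obtain ⟨htI, htU⟩ := mem_filter.1 ht
    obtain ⟨e, he, rfl⟩ := mem_image.1 htI
    refine mem_image_of_mem _ ?_
    simp only [mem_product, mem_univ, and_true, mem_sdiff] at he ⊢
    refine ⟨he, fun heb => ?_⟩
    have := (hb _ heb).2 e.2
    exact absurd htU (not_lt.2 this)
  have h5 := (card_le_card h4).trans card_image_le
  rw [card_product, card_univ, Fintype.card_fin, card_sdiff_of_subset hba] at h5
  have h6 := hf ha
  have h7 := card_le_card hba
  simp only [U] at h5
  omega

theorem Inv.rounds {n m : ℕ} {f : Fin n × Fin 17 → Fin m} {real : Fin n → Bool}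
    {v : Fin n → Payload w} {μ : Mem (Fin n) (Fin 17) (Fin m) w}
    (hf : ∀ s : Finset (Fin n), s.Nonempty → 64 * s.card ≤ m →
      9 * s.card < ((s ×ˢ univ).image f).card)
    (h : Inv f real v μ) (hμ : 64 * (active μ).card ≤ m) (r : ℕ) :
    let μ' := exec ((List.range r).flatMap fun _ => Prog.round f univ.toList univ.toList) μ
    Inv f real v μ' ∧ 17 ^ r * (active μ').card ≤ 16 ^ r * (active μ).card := by
  induction r with
  | zero => simpa [exec] using h
  | succ r ih =>
    obtain ⟨h1, h2⟩ := ih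
    simp only [List.range_succ, List.flatMap_append, exec_append, List.flatMap_singleton]
    set μ' := exec ((List.range r).flatMap fun _ => Prog.round f univ.toList univ.toList) μ
    obtain ⟨h3, h4⟩ := h1.round
    refine ⟨h3, ?_⟩
    -- The active set is no larger than initially, so it is still in the range where the graph
    -- expands.
    have hle : (active μ').card ≤ (active μ).card := by
      have : 16 ^ r * (active μ).card ≤ 17 ^ r * (active μ).card := by gcongr; norm_num
      exact Nat.le_of_mul_le_mul_left (h2.trans this) (by positivity)
    have h5 := peel_card_le f _ _ (fun hne => hf _ hne (by omega)) h4
    rw [pow_succ, pow_succ, mul_assoc]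
    calc _ ≤ 17 ^ r * (16 * (active μ').card) := by gcongr
      _ = 16 * (17 ^ r * (active μ').card) := by ring
      _ ≤ 16 * (16 ^ r * (active μ).card) := by gcongr
      _ = _ := by ring

/-! ### Moving the payloads along the matching. -/

theorem move_out (L : List (S × D)) (m : Mem S D T w) (t : T) :
    (exec (L.flatMap (move f)) m).1 (out t) = true ↔
      m.1 (out t) = true ∨ ∃ e ∈ L, m.1 (sel e) = true ∧ f e = t := by
  induction L generalizing m with
  | nil => simp [exec]
  | cons e L ih =>
    have hsel : ∀ e', (exec (move f e) m).1 (sel e') = m.1 (sel e') := by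
      intro e'; simp [exec, move, step]
    rw [List.flatMap_cons, exec_append, ih]
    simp only [hsel, List.exists_mem_cons_iff]
    by_cases ht : t = f e
    · subst ht
      simp [exec, move, step, or_assoc]
    · simp [exec, move, step, ht, Ne.symm ht]

theorem move_pay (L : List (S × D)) (m : Mem S D T w) (v : S → Payload w)
    (hv : ∀ s, m.2 (.inl s) = v s)
    (hinj : ∀ e e' : S × D, m.1 (sel e) = true → m.1 (sel e') = true → f e = f e' → e = e')
    (e : S × D) (heL : e ∈ L) (he : m.1 (sel e) = true) :
    (exec (L.flatMap (move f)) m).2 (.inr (f e)) = v e.1 := by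
  have hsel : ∀ (m : Mem S D T w) a e', (exec (move f a) m).1 (sel e') = m.1 (sel e') := by
    intro m a e'; simp [exec, move, step]
  have hpay : ∀ (m : Mem S D T w) a s, (exec (move f a) m).2 (.inl s) = m.2 (.inl s) := by
    intro m a s; simp [exec, move, step]
  have hout : ∀ (m : Mem S D T w) a t, (exec (move f a) m).2 (.inr t) =
      if t = f a then (if m.1 (sel a) then m.2 (.inl a.1) else m.2 (.inr t)) else m.2 (.inr t) := by
    intro m a t
    by_cases ht : t = f a <;> simp [exec, move, step, ht]
  induction L generalizing m with
  | nil => simp at heL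
  | cons a L ih =>
    rw [List.flatMap_cons, exec_append]
    by_cases heL' : e ∈ L
    · exact ih _ (by simpa [hpay] using hv) (by simpa only [hsel] using hinj) heL' (by rw [hsel, he])
    -- This is the last occurrence of `e`. A later write to its target would need a selected edge
    -- with the same right end, which injectivity makes equal to `e`.
    · obtain rfl : e = a := by simpa [heL'] using heL
      refine (exec_flatMap_induction (move f) (fun m' => (∀ e', m'.1 (sel e') = m.1 (sel e')) ∧
        (∀ s, m'.2 (.inl s) = v s) ∧ m'.2 (.inr (f e)) = v e.1) ?_ L _ ⟨?_, ?_, ?_⟩).2.2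
      · rintro b m' ⟨h1, h2, h3⟩
        refine ⟨by simpa [hsel] using h1, by simpa [hpay] using h2, ?_⟩
        rw [hout]
        split_ifs with h4 h5
        · rw [h1] at h5
          rw [h2, hinj e b he h5 h4]
        · exact h3
        · exact h3
      · exact hsel _ _
      · simpa [hpay] using hv
      · simp [hout, he, hv]

end Prog

/-! ### The compactor circuit: cost and correctness. -/

open Finset

/-- The circuit of the compactor on the graph `f`. -/
noncomputable def compactorCircuit {n m : ℕ} (f : Fin n × Fin 17 → Fin m) (hn : 0 < n) (rounds : ℕ) :
    ArrayCircuit n m :=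
  (Instr.compile (Prog.compactor f univ.toList univ.toList rounds)
    (.output BitReg.out Sum.inr)).rename
    -- Registers other than `act` and the input payloads start with junk from input 0, hence `0 <
    -- n`. The program clears the bit registers before using them; junk payloads remain only in
    -- unmatched outputs, which are dummies.
    (fun x => match x with
      | .act s => s
      | _ => ⟨0, hn⟩)
    (Sum.elim id fun _ => ⟨0, hn⟩)

theorem boolGates_compactorCircuit {n m : ℕ} (f : Fin n × Fin 17 → Fin m) (hn : 0 < n) (r : ℕ) :
    (compactorCircuit f hn r).boolGates = 34 * n + m + r * (2 * m + 68 * n) := by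
  rw [compactorCircuit, Circuit.boolGates_rename, Instr.boolGates_compile,
    Prog.bitCount_compactor]
  simp [Circuit.boolGates]
  ring

theorem selectorGates_compactorCircuit {n m : ℕ} (f : Fin n × Fin 17 → Fin m) (hn : 0 < n)
    (r : ℕ) : (compactorCircuit f hn r).selectorGates = 17 * n := by
  rw [compactorCircuit, Circuit.selectorGates_rename, Instr.selectorGates_compile,
    Prog.payCount_compactor]
  simp [Circuit.selectorGates]
  ring

theorem card_realElements {n w : ℕ} (I : Fin n → Element w) :
    Multiset.card (realElements I) = (univ.filter fun s => (I s).1 = true).card := by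
  rw [realElements, Multiset.filter_map, Multiset.card_map]
  rfl

theorem realElements_eq_map {n w : ℕ} (I : Fin n → Element w) :
    realElements I =
      (univ.filter fun s => (I s).1 = true).val.map fun s => (true, (I s).2) := by
  rw [realElements, Multiset.filter_map]
  refine Multiset.map_congr rfl fun s hs => ?_
  have : (I s).1 = true := by simpa using hs
  exact Prod.ext this rfl

theorem realElements_run_compactorCircuit {n m w : ℕ} {f : Fin n × Fin 17 → Fin m}
    (hf : ∀ s : Finset (Fin n), s.Nonempty → 64 * s.card ≤ m →
      9 * s.card < ((s ×ˢ univ).image f).card) (hn : 0 < n) (r : ℕ) (I : Fin n → Element w)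
    (hI : 64 * Multiset.card (realElements I) ≤ m)
    (hr : 16 ^ r * Multiset.card (realElements I) < 17 ^ r) :
    realElements (ArrayCircuit.run (compactorCircuit f hn r) I) = realElements I := by
  let μ₀ : Mem (Fin n) (Fin 17) (Fin m) w :=
    ((fun i => (I i).1) ∘ (fun x : BitReg (Fin n) (Fin 17) (Fin m) => match x with
      | .act s => s
      | _ => ⟨0, hn⟩), (fun i => (I i).2) ∘ (Sum.elim id fun _ => ⟨0, hn⟩))
  set μ₁ := Instr.exec ((univ : Finset (Fin n × Fin 17)).toList.flatMap
    fun e => [Prog.clear (.sel e)]) μ₀ with hμ₁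
  set μ₂ := Instr.exec ((univ : Finset (Fin m)).toList.flatMap
    fun t => [Prog.clear (.out t)]) μ₁ with hμ₂
  set μ₃ := Instr.exec ((List.range r).flatMap
    fun _ => Prog.round f univ.toList univ.toList) μ₂ with hμ₃
  set μ₄ := Instr.exec ((univ : Finset (Fin n × Fin 17)).toList.flatMap (Prog.move f)) μ₃ with hμ₄
  have hrun : ArrayCircuit.run (compactorCircuit f hn r) I =
      fun t => (μ₄.1 (.out t), μ₄.2 (.inr t)) := by
    simp only [ArrayCircuit.run, compactorCircuit, Circuit.eval_rename, Instr.eval_compile,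
      Prog.compactor, Instr.exec_append]
    rfl
  have hbit : ∀ x, μ₂.1 x = ((μ₀.1 x && !decide (∃ e : Fin n × Fin 17, x = .sel e)) &&
      !decide (∃ t : Fin m, x = .out t)) := by
    intro x
    have h1 := Prog.exec_clear (fun e : Fin n × Fin 17 => [BitReg.sel e])
      (univ : Finset (Fin n × Fin 17)).toList μ₀ x
    have h2 := Prog.exec_clear (fun t : Fin m => [BitReg.out t])
      (univ : Finset (Fin m)).toList μ₁ x
    simp only [mem_toList, mem_univ, true_and, List.mem_singleton] at h1 h2
    exact h2.trans (congrArg (· && _) h1)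
  have hpay : μ₂.2 = μ₀.2 := by
    refine Prog.exec_flatMap_induction _ (fun μ' => μ'.2 = μ₀.2) ?_ _ _
      (Prog.exec_flatMap_induction _ (fun μ' => μ'.2 = μ₀.2) ?_ _ _ rfl)
    all_goals
      intro t μ' h'
      simpa [Instr.exec, Prog.clear, Instr.step] using h'
  have hact : ∀ s, μ₂.1 (.act s) = (I s).1 := by
    intro s
    rw [hbit]
    simp [μ₀]
  have hsel : ∀ e, μ₂.1 (.sel e) = false := by
    intro e
    rw [hbit]
    simp
  have hinv : Prog.Inv f (fun s => (I s).1) (fun s => (I s).2) μ₂ := by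
    constructor
    · simp [hact, hsel]
    · simp [hsel]
    · simp [hsel]
    · simp [hsel]
    · simp [hsel]
    · intro t
      rw [hbit]
      simp
    · intro s
      rw [hpay]
      rfl
  have hcard : (Prog.active μ₂).card = Multiset.card (realElements I) := by
    rw [card_realElements]
    simp only [Prog.active, hact]
  obtain ⟨hinv₃, hlt⟩ := hinv.rounds hf (by rw [hcard]; exact hI) r
  rw [← hμ₃] at hinv₃ hlt
  -- Here `17 ^ r * |active| < 17 ^ r`, so the integer `|active|` is 0.
  have hempty : Prog.active μ₃ = ∅ := by
    rw [← card_eq_zero]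
    rw [hcard] at hlt
    by_contra hne
    have : 17 ^ r * 1 ≤ 17 ^ r * (Prog.active μ₃).card :=
      Nat.mul_le_mul_left _ (Nat.one_le_iff_ne_zero.2 hne)
    omega
  have hreal : ∀ s, (I s).1 = true ↔ ∃ i, μ₃.1 (.sel (s, i)) = true := by
    intro s
    have : ¬ μ₃.1 (.act s) = true := fun h => by
      have hs : s ∈ Prog.active μ₃ := by simp [Prog.active, h]
      simp [hempty] at hs
    simpa [this] using hinv₃.real_iff s
  -- The selected edges correspond bijectively to the real inputs by left end and to the real
  -- outputs by right end, so both multisets are images of `M`.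
  let M := (univ : Finset (Fin n × Fin 17)).filter fun e => μ₃.1 (.sel e) = true
  have hout : (univ.filter fun t => μ₄.1 (.out t) = true) = M.image f := by
    ext t
    simp only [mem_filter, mem_univ, true_and, mem_image, M]
    rw [hμ₄, Prog.move_out]
    simp [hinv₃.out_eq]
  have hin : (univ.filter fun s => (I s).1 = true) = M.image Prod.fst := by
    ext s
    simp [hreal, M]
  have hinj₁ : Set.InjOn f M := fun e he e' he' h =>
    hinv₃.dst_inj e e' (by simpa [M] using he) (by simpa [M] using he') h
  have hinj₂ : Set.InjOn Prod.fst (M : Set (Fin n × Fin 17)) := fun e he e' he' h =>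
    hinv₃.src_inj e e' (by simpa [M] using he) (by simpa [M] using he') h
  rw [hrun, realElements_eq_map, realElements_eq_map]
  simp only
  rw [hout, hin, image_val_of_injOn hinj₁, image_val_of_injOn hinj₂, Multiset.map_map,
    Multiset.map_map]
  refine Multiset.map_congr rfl fun e he => ?_
  have he' : μ₃.1 (.sel e) = true := by simpa [M] using he
  simp only [Function.comp_apply]
  rw [hμ₄, Prog.move_pay f _ μ₃ (fun s => (I s).2) hinv₃.pay_eq hinv₃.dst_inj e (by simp) he']

/-! ### Small `n`, and the choice of parameters. -/

/-- As `n / 128 < 1`, all inputs are dummies and any selection of them is a correct output. Using no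
gates matters for `n ≤ 1`, where `n log n = 0`. -/
theorem exists_looseCompactor_of_lt {n : ℕ} (hn : n < 128) (w : ℕ) :
    ∃ c : ArrayCircuit n (n / 2), IsLooseCompactor n w c ∧ c.boolGates = 0 ∧
      c.selectorGates = 0 := by
  have h : n / 2 ≤ n := Nat.div_le_self n 2
  refine ⟨.output (Fin.castLE h) (Fin.castLE h), fun I hI => ?_, rfl, rfl⟩
  have h0 : Multiset.card (realElements I) = 0 := by
    have h1 : (n : ℝ) < 128 := by exact_mod_cast hn
    have h2 : (Multiset.card (realElements I) : ℝ) < 1 := by linarith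
    have h3 : Multiset.card (realElements I) < 1 := by exact_mod_cast h2
    omega
  rw [Multiset.card_eq_zero.1 h0]
  rw [card_realElements, card_eq_zero, filter_eq_empty_iff] at h0
  rw [← Multiset.card_eq_zero, card_realElements, card_eq_zero, filter_eq_empty_iff]
  exact fun t _ => h0 (mem_univ (Fin.castLE h t))

/-- From `16 / 17 ≤ exp (-1 / 17)`, more than `17 log n` factors bring `n` below 1. -/
theorem sixteen_pow_mul_lt {n r : ℕ} (hn : 0 < n) (hr : 17 * Real.log n < r) :
    16 ^ r * n < 17 ^ r := by
  have hn' : (0 : ℝ) < n := by exact_mod_cast hn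
  have h1 : (16 / 17 : ℝ) ≤ Real.exp (-(1 / 17)) := by
    have := Real.add_one_le_exp (-(1 / 17 : ℝ))
    linarith
  have h2 : (16 / 17 : ℝ) ^ r ≤ Real.exp (-(r / 17)) := by
    calc (16 / 17 : ℝ) ^ r ≤ Real.exp (-(1 / 17)) ^ r := by gcongr
      _ = _ := by rw [← Real.exp_nat_mul]; congr 1; ring
  have h3 : (16 / 17 : ℝ) ^ r * n < 1 := by
    calc (16 / 17 : ℝ) ^ r * n ≤ Real.exp (-(r / 17)) * Real.exp (Real.log n) := by
          rw [Real.exp_log hn']; gcongr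
      _ = Real.exp (Real.log n - r / 17) := by rw [← Real.exp_add]; congr 1; ring
      _ < 1 := by rw [Real.exp_lt_one_iff]; linarith
  rw [div_pow, div_mul_eq_mul_div, div_lt_one (by positivity)] at h3
  exact_mod_cast h3

theorem exists_looseCompactor_of_le {n : ℕ} (hn : 128 ≤ n) (w : ℕ) :
    ∃ c : ArrayCircuit n (n / 2), IsLooseCompactor n w c ∧
      (c.boolGates : ℝ) ≤ 2000 * ((n : ℝ) * Real.log n) ∧
      (c.selectorGates : ℝ) ≤ 2000 * (n : ℝ) := by
  obtain ⟨f, hf⟩ := exists_expander (n := n) (m := n / 2) (by omega) (by omega)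
  have hn0 : (128 : ℝ) ≤ n := by exact_mod_cast hn
  have hlog : 1 ≤ Real.log n := by
    rw [Real.le_log_iff_exp_le (by linarith)]
    have := Real.exp_one_lt_d9
    linarith
  refine ⟨compactorCircuit f (by omega) (⌊17 * Real.log n⌋₊ + 1), fun I hI => ?_, ?_, ?_⟩
  · have hI' : 128 * Multiset.card (realElements I) ≤ n := by
      have : (128 : ℝ) * Multiset.card (realElements I) ≤ n := by linarith
      exact_mod_cast this
    refine realElements_run_compactorCircuit hf _ _ I (by omega) ?_
    refine lt_of_le_of_lt (Nat.mul_le_mul_left _ (by omega : _ ≤ n))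
      (sixteen_pow_mul_lt (by omega) ?_)
    push_cast
    exact Nat.lt_floor_add_one _
  · rw [boolGates_compactorCircuit]
    have h1 : ((⌊17 * Real.log n⌋₊ : ℕ) : ℝ) ≤ 17 * Real.log n := Nat.floor_le (by linarith)
    have h2 : ((n / 2 : ℕ) : ℝ) ≤ n := by exact_mod_cast Nat.div_le_self n 2
    push_cast
    have h3 : (n : ℝ) ≤ n * Real.log n := le_mul_of_one_le_right (by linarith) hlog
    -- With `1 ≤ log n` absorbing the extra round, the total is at most `35 n + 18 * 70 * n log n ≤
    -- 1295 n log n`.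
    calc (34 * n + (n / 2 : ℕ) + (⌊17 * Real.log n⌋₊ + 1) * (2 * (n / 2 : ℕ) + 68 * n) : ℝ) ≤
          34 * n + n + (17 * Real.log n + Real.log n) * (2 * n + 68 * n) := by gcongr
      _ ≤ _ := by linarith
  · rw [selectorGates_compactorCircuit]
    push_cast
    linarith

end LooseCompaction

theorem mainTheorem7 :
    ∃ C : ℝ, 0 < C ∧ ∀ n w : ℕ, ∃ c : LooseCompaction.ArrayCircuit n (n / 2),
      LooseCompaction.IsLooseCompactor n w c ∧
      (c.boolGates : ℝ) ≤ C * ((n : ℝ) * Real.log (n : ℝ)) ∧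
      (c.selectorGates : ℝ) ≤ C * (n : ℝ) := by
  refine ⟨2000, by norm_num, fun n w => ?_⟩
  rcases lt_or_ge n 128 with hn | hn
  · obtain ⟨c, h1, h2, h3⟩ := LooseCompaction.exists_looseCompactor_of_lt hn w
    refine ⟨c, h1, ?_, ?_⟩
    · rw [h2, Nat.cast_zero]
      have := Real.log_natCast_nonneg n
      positivity
    · rw [h3, Nat.cast_zero]
      positivity
  · exact LooseCompaction.exists_looseCompactor_of_le hn w
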